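/- Let $m,n$ be non-negative integers and let $H$ be a random $m\times n$ complex matrix whose entries are independent, each with the zero-mean unit-variance circularly symmetric complex Gaussian distribution (independent real and imaginary parts, each real Gaussian with mean $0$ and variance $1/2$). For a complex matrix $A$, let $A^*$ denote its Hermitian conjugate. Let $D,\tilde D$ be deterministic complex $m\times n$ matrices such that $D^*D-\tilde D^*\tilde D$ is positive semidefinite. Then, for every real $t\ge 0$ and every positive semidefinite Hermitian complex $n\times n$ matrix $K$, $$P\Bigl(\log\det\bigl(I_m+(H+D)K(H+D)^*\bigr)\le t\Bigr)\;\le\; P\Bigl(\log\det\bigl(I_m+(H+\tilde D)K(H+\tilde D)^*\bigr)\le t\Bigr),$$ where $\log$ is the natural logarithm and $I_m$ is the $m\times m$ identity matrix. -/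

import Mathlib

open MeasureTheory ProbabilityTheory
open scoped Matrix ComplexOrder NNReal

/-- The zero-mean unit-variance circularly symmetric complex Gaussian law on `ℂ`: real and imaginary
parts are independent real Gaussians with mean `0` and variance `1/2` each. -/
noncomputable def stdComplexGaussian : Measure ℂ :=
  ((gaussianReal 0 (1 / 2 : ℝ≥0)).prod (gaussianReal 0 (1 / 2 : ℝ≥0))).map
    Complex.measurableEquivRealProd.symm

/-- `H` is a random `m × n` matrix on the probability space `(Ω, P)` whose components are
independent, each with the zero-mean unit-variance circularly symmetric complex Gaussian law. -/
structure IsIIDStdComplexGaussian {Ω : Type*} [MeasurableSpace Ω] (P : Measure Ω) {m n : ℕ}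
    (H : Ω → Matrix (Fin m) (Fin n) ℂ) : Prop where
  hasLaw : ∀ i j, HasLaw (fun ω ↦ H ω i j) stdComplexGaussian P
  indep : iIndepFun (fun (p : Fin m × Fin n) ω ↦ H ω p.1 p.2) P

/-- The value `log det (I_m + A K A*)`. For positive semidefinite `K` the determinant is a real
number that is at least `1`, so passing to the real part only changes its type. -/
noncomputable def logDetValue {m n : ℕ} (K : Matrix (Fin n) (Fin n) ℂ)
    (A : Matrix (Fin m) (Fin n) ℂ) : ℝ :=
  Real.log (1 + A * K * Aᴴ).det.re

/-! The law of `H` and the determinant are both invariant under left multiplication by a unitary.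
The hypothesis on the means says exactly that `D' = C D` for a contraction `C`, and `C = U S W` with
`U`, `W` unitary and `S` diagonal with entries in [0, 1]. The unitaries are absorbed by invariance,
so it remains to scale down the rows of the mean, one at a time.

With the other rows fixed, the determinant equals `β (1 + q(y))`, where `β > 0` and `q` is a
positive semidefinite Hermitian form in the row `y`. Its sublevel sets are therefore centred,
possibly degenerate, ellipsoids, and the claim becomes an Anderson-type inequality: shrinking the
shift of such a set does not lower its Gaussian mass. Rotating to principal axes and shrinking one
real coordinate at a time reduces this to a shifted interval under a real Gaussian, which is settled
by a reflection. -/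

/-! ### Gram matrices and contractions -/

/-- Two linear maps into a finite-dimensional space with pointwise equal norms differ by a linear
isometry of the codomain. -/
theorem LinearMap.exists_linearIsometry_comp_eq {E V : Type*} [NormedAddCommGroup E]
    [InnerProductSpace ℂ E] [NormedAddCommGroup V] [InnerProductSpace ℂ V]
    [FiniteDimensional ℂ V] (f g : E →ₗ[ℂ] V) (h : ∀ x, ‖f x‖ = ‖g x‖) :
    ∃ U : V →ₗᵢ[ℂ] V, ∀ x, f x = U (g x) := by
  have hker : g.ker ≤ f.ker := by
    intro x hx
    rw [LinearMap.mem_ker] at hx ⊢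
    rw [← norm_eq_zero, h, hx, norm_zero]
  let L₀ : g.range →ₗ[ℂ] V := (g.ker.liftQ f hker) ∘ₗ g.quotKerEquivRange.symm.toLinearMap
  have hL₀ : ∀ x, L₀ ⟨g x, LinearMap.mem_range_self g x⟩ = f x := by
    intro x
    have : g.quotKerEquivRange.symm ⟨g x, LinearMap.mem_range_self g x⟩ = g.ker.mkQ x :=
      LinearMap.quotKerEquivRange_symm_apply_image g x _
    simp [L₀, this]
  let L : g.range →ₗᵢ[ℂ] V :=
    { L₀ with
      norm_map' := by
        rintro ⟨_, x, rfl⟩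
        change ‖L₀ _‖ = ‖g x‖
        rw [hL₀, h] }
  -- Finite dimension of `V` lets the isometry on the range of `g` extend to all of `V`.
  refine ⟨L.extend, fun x ↦ ?_⟩
  rw [← hL₀ x]
  exact (L.extend_apply ⟨g x, LinearMap.mem_range_self g x⟩).symm

namespace Matrix

theorem norm_toLp_mulVec_sq {m n : Type*} [Fintype m] [Fintype n] (A : Matrix m n ℂ)
    (x : n → ℂ) :
    ((‖WithLp.toLp 2 (A *ᵥ x)‖ ^ 2 : ℝ) : ℂ) = star x ⬝ᵥ ((Aᴴ * A) *ᵥ x) := by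
  have := inner_self_eq_norm_sq_to_K (𝕜 := ℂ) (WithLp.toLp 2 (A *ᵥ x))
  rw [EuclideanSpace.inner_eq_star_dotProduct] at this
  push_cast
  refine this.symm.trans ?_
  rw [← mulVec_mulVec, dotProduct_mulVec, vecMul_conjTranspose, star_star, dotProduct_comm]

/-- Matrices with the same Gram matrix differ by a unitary factor on the left. -/
theorem exists_unitary_mul_eq_of_conjTranspose_mul_self_eq {m n : Type*} [Fintype m]
    [DecidableEq m] [Fintype n] [DecidableEq n] {A B : Matrix m n ℂ} (h : Aᴴ * A = Bᴴ * B) :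
    ∃ U ∈ unitaryGroup m ℂ, A = U * B := by
  obtain ⟨U, hU⟩ := LinearMap.exists_linearIsometry_comp_eq (toEuclideanLin A) (toEuclideanLin B)
    (fun x ↦ by
      have hA := norm_toLp_mulVec_sq A x.ofLp
      rw [h, ← norm_toLp_mulVec_sq, Complex.ofReal_inj] at hA
      exact (pow_left_inj₀ (norm_nonneg _) (norm_nonneg _) two_ne_zero).1 hA)
  have hM : toEuclideanLin (toEuclideanLin.symm U.toLinearMap) = U.toLinearMap :=
    LinearEquiv.apply_symm_apply _ _
  set M := toEuclideanLin.symm U.toLinearMap with hMdef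
  have hMv : ∀ x, WithLp.toLp 2 (M *ᵥ x) = U (WithLp.toLp 2 x) := fun x ↦ by
    have := LinearMap.congr_fun hM (WithLp.toLp 2 x)
    simpa using this
  refine ⟨M, ?_, ?_⟩
  · rw [mem_unitaryGroup_iff']
    ext i j
    have := U.inner_map_map (WithLp.toLp 2 (Pi.single i 1)) (WithLp.toLp 2 (Pi.single j 1))
    rw [← hMv, ← hMv, EuclideanSpace.inner_eq_star_dotProduct,
      EuclideanSpace.inner_eq_star_dotProduct] at this
    simpa [mul_apply, dotProduct, one_apply, mul_comm, Pi.single_apply, star_eq_conjTranspose,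
      eq_comm (a := i)] using this
  · ext i j
    have := congrArg (fun v ↦ v.ofLp i) (hU (WithLp.toLp 2 (Pi.single j 1)))
    have hB : toEuclideanLin B (WithLp.toLp 2 (Pi.single j 1)) =
        WithLp.toLp 2 (B *ᵥ Pi.single j 1) := rfl
    rw [hB, ← hMv, mulVec_mulVec] at this
    simpa using this

/-- If `BᴴB ≤ AᴴA` in the Loewner order then `B = C A` for a contraction `C`. -/
theorem exists_contraction_mul_eq {m n : Type*} [Fintype m] [DecidableEq m] [Fintype n]
    [DecidableEq n] {A B : Matrix m n ℂ} (h : (Aᴴ * A - Bᴴ * B).PosSemidef) :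
    ∃ C : Matrix m m ℂ, (1 - Cᴴ * C).PosSemidef ∧ B = C * A := by
  open scoped MatrixOrder in
  obtain ⟨E, hE⟩ := CStarAlgebra.nonneg_iff_eq_star_mul_self.mp h.nonneg
  rw [star_eq_conjTranspose] at hE
  -- `E` supplies the missing part of the Gram matrix and zero rows match the sizes; `C` is then the
  -- upper left block of the resulting unitary.
  have hG : (fromRows B E)ᴴ * fromRows B E =
      (fromRows A (0 : Matrix n n ℂ))ᴴ * fromRows A (0 : Matrix n n ℂ) := by
    simp only [conjTranspose_fromRows_eq_fromCols_conjTranspose, fromCols_mul_fromRows, ← hE]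
    simp
  obtain ⟨U, hU, hUe⟩ := exists_unitary_mul_eq_of_conjTranspose_mul_self_eq hG
  rw [← fromBlocks_toBlocks U, fromBlocks_mul_fromRows] at hUe
  refine ⟨U.toBlocks₁₁, ?_, ?_⟩
  · have h1 := mem_unitaryGroup_iff'.1 hU
    rw [← fromBlocks_toBlocks U, star_eq_conjTranspose, fromBlocks_conjTranspose,
      fromBlocks_multiply, ← fromBlocks_one, fromBlocks_inj] at h1
    -- The first block column of a unitary has orthonormal columns, so `1 - CᴴC` is the Gram matrix
    -- of the lower left block.
    rw [← h1.1, add_sub_cancel_left]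
    exact posSemidef_conjTranspose_mul_self _
  · have := congrArg toRows₁ hUe
    simpa using this

/-- A contraction factors as `U S W` with `U`, `W` unitary and `S` diagonal with entries in
`[0, 1]`. -/
theorem exists_unitary_diagonal_unitary {m : Type*} [Fintype m] [DecidableEq m]
    {C : Matrix m m ℂ} (hC : (1 - Cᴴ * C).PosSemidef) :
    ∃ U ∈ unitaryGroup m ℂ, ∃ W ∈ unitaryGroup m ℂ, ∃ s : m → ℝ, (∀ i, 0 ≤ s i ∧ s i ≤ 1) ∧
      C = U * (diagonal (fun i ↦ (s i : ℂ)) * W) := by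
  have hP := posSemidef_conjTranspose_mul_self C
  set V := hP.1.eigenvectorUnitary with hV
  set e := hP.1.eigenvalues with he
  have hsp : Cᴴ * C = (V : Matrix m m ℂ) * diagonal (fun i ↦ (e i : ℂ)) * (V : Matrix m m ℂ)ᴴ := by
    have := hP.1.spectral_theorem
    rw [Unitary.conjStarAlgAut_apply] at this
    exact this
  have hVV : (V : Matrix m m ℂ)ᴴ * (V : Matrix m m ℂ) = 1 := mem_unitaryGroup_iff'.1 V.2
  have hVV' : (V : Matrix m m ℂ) * (V : Matrix m m ℂ)ᴴ = 1 := mem_unitaryGroup_iff.1 V.2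
  have he0 : ∀ i, 0 ≤ e i := hP.eigenvalues_nonneg
  have he1 : ∀ i, e i ≤ 1 := by
    intro i
    have h1 := hC.conjTranspose_mul_mul_same (V : Matrix m m ℂ)
    have h2 : (V : Matrix m m ℂ)ᴴ * (1 - Cᴴ * C) * V = 1 - diagonal (fun i ↦ (e i : ℂ)) := by
      rw [hsp, mul_sub, sub_mul, mul_one, hVV]
      congr 1
      simp only [← mul_assoc, hVV, one_mul]
      rw [mul_assoc, hVV, mul_one]
    rw [h2] at h1
    have h3 := h1.diag_nonneg (i := i)
    simp only [sub_apply, one_apply_eq, diagonal_apply_eq, sub_nonneg] at h3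
    exact_mod_cast h3
  -- Polar decomposition: `C` and `√e Vᴴ` have the same Gram matrix, so no invertibility of `C` is
  -- needed.
  obtain ⟨U, hU, hUe⟩ := exists_unitary_mul_eq_of_conjTranspose_mul_self_eq
    (A := C) (B := diagonal (fun i ↦ ((√(e i) : ℝ) : ℂ)) * (V : Matrix m m ℂ)ᴴ) (by
      rw [hsp, conjTranspose_mul, conjTranspose_conjTranspose, diagonal_conjTranspose]
      have : diagonal (fun i ↦ (e i : ℂ)) = diagonal (star fun i ↦ ((√(e i) : ℝ) : ℂ)) *
          diagonal (fun i ↦ ((√(e i) : ℝ) : ℂ)) := by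
        rw [diagonal_mul_diagonal]
        congr 1
        ext i
        simp [← Complex.ofReal_mul, Real.mul_self_sqrt (he0 i)]
      rw [this]
      simp only [mul_assoc])
  refine ⟨U, hU, (V : Matrix m m ℂ)ᴴ, ?_, fun i ↦ √(e i), fun i ↦ ⟨Real.sqrt_nonneg _, ?_⟩, hUe⟩
  · exact (star V).2
  · exact Real.sqrt_le_one.2 (he1 i)

end Matrix

/-! ### Shifted intervals and discs under a Gaussian -/

theorem gaussianPDF_le_of_sq_le {v : ℝ≥0} {x y : ℝ} (h : y ^ 2 ≤ x ^ 2) :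
    gaussianPDF 0 v x ≤ gaussianPDF 0 v y := by
  rw [gaussianPDF, gaussianPDF, gaussianPDFReal, gaussianPDFReal]
  apply ENNReal.ofReal_le_ofReal
  simp only [sub_zero]
  gcongr

/-- The centred Gaussian mass of a translated interval decreases with the size of the shift. -/
theorem gaussianReal_setOf_add_sq_le_of_nonneg {v : ℝ≥0} (hv : v ≠ 0) {a b : ℝ} (ha : 0 ≤ a)
    (hab : a ≤ b) (c : ℝ) :
    gaussianReal 0 v {x | (x + b) ^ 2 ≤ c} ≤ gaussianReal 0 v {x | (x + a) ^ 2 ≤ c} := by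
  set A := {x : ℝ | (x + b) ^ 2 ≤ c}
  set B := {x : ℝ | (x + a) ^ 2 ≤ c}
  have hA : MeasurableSet A := measurableSet_le (by fun_prop) (by fun_prop)
  have hB : MeasurableSet B := measurableSet_le (by fun_prop) (by fun_prop)
  -- This reflection about `-(a + b)/2` exchanges the two intervals; it carries `A \ B` to points no
  -- farther from 0, where the density is at least as large.
  have hσ : MeasurePreserving (fun x : ℝ ↦ -(a + b) - x) volume volume :=
    Measure.measurePreserving_sub_left volume _
  have hpre : (fun x : ℝ ↦ -(a + b) - x) ⁻¹' (B \ A) = A \ B := by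
    ext x
    simp only [A, B, Set.mem_preimage, Set.mem_sdiff, Set.mem_ofPred_eq]
    rw [show (-(a + b) - x + a) ^ 2 = (x + b) ^ 2 by ring,
      show (-(a + b) - x + b) ^ 2 = (x + a) ^ 2 by ring]
  have key : gaussianReal 0 v (A \ B) ≤ gaussianReal 0 v (B \ A) := by
    rw [gaussianReal_apply _ hv, gaussianReal_apply _ hv,
      ← hσ.setLIntegral_comp_preimage (hB.diff hA) (measurable_gaussianPDF _ _), hpre]
    refine setLIntegral_mono ((measurable_gaussianPDF _ _).comp hσ.measurable) fun x hx ↦ ?_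
    apply gaussianPDF_le_of_sq_le
    have h1 : (x + b) ^ 2 ≤ c := hx.1
    have h2 : ¬ (x + a) ^ 2 ≤ c := hx.2
    have h3 : (b - a) * (2 * x + a + b) < 0 := by nlinarith
    have h4 : 2 * x + a + b < 0 := by
      by_contra! h
      nlinarith [mul_nonneg (sub_nonneg.2 hab) h]
    nlinarith
  rw [← measure_inter_add_sdiff A hB, ← measure_inter_add_sdiff B hA, Set.inter_comm B A]
  gcongr

theorem gaussianReal_setOf_add_sq_le {v : ℝ≥0} (hv : v ≠ 0) {s : ℝ} (hs0 : 0 ≤ s) (hs1 : s ≤ 1)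
    (b c : ℝ) :
    gaussianReal 0 v {x | (x + b) ^ 2 ≤ c} ≤ gaussianReal 0 v {x | (x + s * b) ^ 2 ≤ c} := by
  rcases le_total 0 b with hb | hb
  · exact gaussianReal_setOf_add_sq_le_of_nonneg hv (by positivity) (by nlinarith) c
  · have hneg : ∀ d : ℝ, gaussianReal 0 v {x | (x + d) ^ 2 ≤ c} =
        gaussianReal 0 v {x | (x + -d) ^ 2 ≤ c} := fun d ↦ by
      have hm : MeasurableSet {x : ℝ | (x + -d) ^ 2 ≤ c} :=
        measurableSet_le (by fun_prop) (by fun_prop)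
      conv_rhs => rw [← neg_zero, ← gaussianReal_map_neg, Measure.map_apply (by fun_prop) hm]
      congr 1
      ext x
      simp only [Set.mem_ofPred_eq, Set.mem_preimage]
      rw [show (-x + -d) ^ 2 = (x + d) ^ 2 by ring]
    rw [hneg b, hneg (s * b)]
    exact gaussianReal_setOf_add_sq_le_of_nonneg hv (by nlinarith) (by nlinarith) c

instance : IsProbabilityMeasure stdComplexGaussian :=
  Measure.isProbabilityMeasure_map (MeasurableEquiv.measurable _).aemeasurable

/-- Every section of a disc parallel to an axis is an interval or empty, so Fubini permits shrinking
first the imaginary and then the real part of the centre. -/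
theorem stdComplexGaussian_setOf_normSq_add_le {s : ℝ} (hs0 : 0 ≤ s) (hs1 : s ≤ 1) (d : ℂ)
    (c : ℝ) :
    stdComplexGaussian {z | Complex.normSq (z + d) ≤ c} ≤
      stdComplexGaussian {z | Complex.normSq (z + s * d) ≤ c} := by
  have hm : ∀ d : ℂ, MeasurableSet {z : ℂ | Complex.normSq (z + d) ≤ c} := fun d ↦
    (isClosed_le (Complex.continuous_normSq.comp (by fun_prop)) continuous_const).measurableSet
  have hv : (1 / 2 : ℝ≥0) ≠ 0 := by norm_num
  have hpre : ∀ d : ℂ, Complex.measurableEquivRealProd.symm ⁻¹'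
      {z : ℂ | Complex.normSq (z + d) ≤ c} =
      {p : ℝ × ℝ | (p.1 + d.re) ^ 2 + (p.2 + d.im) ^ 2 ≤ c} := fun d ↦ by
    ext p
    simp [Complex.measurableEquivRealProd, Complex.normSq_apply, sq]
  have hm' : ∀ a b : ℝ, MeasurableSet {p : ℝ × ℝ | (p.1 + a) ^ 2 + (p.2 + b) ^ 2 ≤ c} :=
    fun a b ↦ measurableSet_le (by fun_prop) (by fun_prop)
  rw [stdComplexGaussian, MeasurableEquiv.map_apply, MeasurableEquiv.map_apply, hpre, hpre]
  simp only [Complex.mul_re, Complex.mul_im, Complex.ofReal_re, Complex.ofReal_im, zero_mul,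
    sub_zero, add_zero]
  refine le_trans (b := ((gaussianReal 0 (1 / 2 : ℝ≥0)).prod (gaussianReal 0 (1 / 2 : ℝ≥0)))
    {p : ℝ × ℝ | (p.1 + d.re) ^ 2 + (p.2 + s * d.im) ^ 2 ≤ c}) ?_ ?_
  · rw [Measure.prod_apply (hm' _ _), Measure.prod_apply (hm' _ _)]
    refine lintegral_mono fun x ↦ ?_
    have := gaussianReal_setOf_add_sq_le hv hs0 hs1 d.im (c - (x + d.re) ^ 2)
    simpa only [Set.preimage_ofPred_eq, le_sub_iff_add_le'] using this
  · rw [Measure.prod_apply_symm (hm' _ _), Measure.prod_apply_symm (hm' _ _)]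
    refine lintegral_mono fun y ↦ ?_
    have := gaussianReal_setOf_add_sq_le hv hs0 hs1 d.re (c - (y + s * d.im) ^ 2)
    simpa only [Set.preimage_ofPred_eq, le_sub_iff_add_le] using this

/-! ### Shrinking one coordinate at a time -/

/-- To compare the product measures of two sets it suffices to compare their sections along one
coordinate. -/
theorem MeasureTheory.Measure.pi_le_pi_of_update {ι : Type*} [Fintype ι] [DecidableEq ι]
    {X : ι → Type*} [∀ i, MeasurableSpace (X i)] (μ : ∀ i, Measure (X i)) [∀ i, SigmaFinite (μ i)]
    (i : ι) {A B : Set (∀ i, X i)} (hA : MeasurableSet A) (hB : MeasurableSet B)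
    (h : ∀ x, μ i {y | Function.update x i y ∈ A} ≤ μ i {y | Function.update x i y ∈ B}) :
    Measure.pi μ A ≤ Measure.pi μ B := by
  rw [← lintegral_indicator_one hA, ← lintegral_indicator_one hB]
  refine lintegral_le_of_lmarginal_le {i} (measurable_one.indicator hA)
    (measurable_one.indicator hB) ?_
  have hsec : ∀ (S : Set (∀ i, X i)), MeasurableSet S → ∀ x,
      ∫⁻ y, S.indicator 1 (Function.update x i y) ∂μ i = μ i {y | Function.update x i y ∈ S} := by
    intro S hS x
    rw [← lintegral_indicator_one]
    · rfl
    · exact (measurable_update x) hS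
  rw [lmarginal_singleton, lmarginal_singleton]
  intro x
  simpa only [hsec A hA, hsec B hB] using h x

/-- Scaling down finitely many factors one at a time does not decrease a functional that is
monotone under scaling a single factor. -/
theorem le_apply_smul_of_le_apply_update_smul {ι E β : Type*} [Fintype ι] [DecidableEq ι]
    [Preorder β] [SMul ℝ E] (p : (ι → E) → β) (s : ι → ℝ)
    (h : ∀ d i, p d ≤ p (Function.update d i (s i • d i))) (d : ι → E) :
    p d ≤ p (fun i ↦ s i • d i) := by
  suffices ∀ T : Finset ι, p d ≤ p (fun i ↦ if i ∈ T then s i • d i else d i) by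
    simpa using this Finset.univ
  intro T
  induction T using Finset.induction with
  | empty => simp
  | insert i T hi ih =>
    refine ih.trans ((h _ i).trans (le_of_eq ?_))
    congr 1
    ext j
    by_cases hj : j = i
    · subst hj; simp [hi]
    · simp [hj]

/-- The mass of an ellipsoid with axes along the coordinates does not decrease when its centre is
scaled down. -/
theorem pi_stdComplexGaussian_setOf_sum_normSq_add_le {ι : Type*} [Fintype ι] {w : ι → ℝ}
    (hw : ∀ i, 0 ≤ w i) {s : ℝ} (hs0 : 0 ≤ s) (hs1 : s ≤ 1) (c : ℝ) (d : ι → ℂ) :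
    Measure.pi (fun _ : ι ↦ stdComplexGaussian)
        {x | ∑ i, w i * Complex.normSq (x i + d i) ≤ c} ≤
      Measure.pi (fun _ : ι ↦ stdComplexGaussian)
        {x | ∑ i, w i * Complex.normSq (x i + (s • d) i) ≤ c} := by
  classical
  have hm : ∀ d : ι → ℂ, MeasurableSet {x : ι → ℂ | ∑ i, w i * Complex.normSq (x i + d i) ≤ c} :=
    fun d ↦ (isClosed_le (continuous_finsetSum _ fun i _ ↦ continuous_const.mul
      (Complex.continuous_normSq.comp (by fun_prop))) continuous_const).measurableSet
  refine le_apply_smul_of_le_apply_update_smul (fun d : ι → ℂ ↦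
    Measure.pi (fun _ : ι ↦ stdComplexGaussian) {x | ∑ i, w i * Complex.normSq (x i + d i) ≤ c})
    (fun _ ↦ s) (fun d i ↦ ?_) d
  refine Measure.pi_le_pi_of_update _ i (hm _) (hm _) fun x ↦ ?_
  simp only [Set.mem_ofPred_eq, Fintype.sum_eq_add_sum_compl i, Function.update_self]
  have hne : ∀ (f : ι → ℂ) (y : ℂ), ∀ j ∈ ({i}ᶜ : Finset ι), Function.update f i y j = f j :=
    fun f y j hj ↦ Function.update_of_ne (by simpa using hj) _ _
  have h1 : ∀ y : ℂ, ∑ j ∈ ({i}ᶜ : Finset ι), w j * Complex.normSq (Function.update x i y j + d j) =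
      ∑ j ∈ ({i}ᶜ : Finset ι), w j * Complex.normSq (x j + d j) := fun y ↦
    Finset.sum_congr rfl fun j hj ↦ by rw [hne x y j hj]
  have h2 : ∀ y : ℂ, ∑ j ∈ ({i}ᶜ : Finset ι), w j * Complex.normSq (Function.update x i y j +
        Function.update d i (s • d i) j) =
      ∑ j ∈ ({i}ᶜ : Finset ι), w j * Complex.normSq (x j + d j) := fun y ↦
    Finset.sum_congr rfl fun j hj ↦ by rw [hne x y j hj, hne d _ j hj]
  simp only [h1, h2, ← le_sub_iff_add_le]
  -- With weight zero the section does not depend on this coordinate; otherwise dividing by the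
  -- weight leaves a disc.
  rcases (hw i).eq_or_lt with h0 | h0
  · simp [← h0]
  · simp only [← le_div_iff₀' h0]
    exact stdComplexGaussian_setOf_normSq_add_le hs0 hs1 (d i) _

/-! ### Unitary invariance of the Gaussian law -/

theorem charFunDual_gaussianReal (v : ℝ≥0) (L : StrongDual ℝ ℝ) :
    charFunDual (gaussianReal 0 v) L = Complex.exp (-(v * L 1 ^ 2 / 2 : ℝ)) := by
  have h1 : (InnerProductSpace.toDual ℝ ℝ).symm L = L 1 := by
    have := InnerProductSpace.toDual_symm_apply (𝕜 := ℝ) (x := (1 : ℝ)) (y := L)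
    simpa using this
  rw [← charFun_toDual_symm_eq_charFunDual, charFun_gaussianReal, h1]
  simp

theorem charFunDual_stdComplexGaussian (L : StrongDual ℝ ℂ) :
    charFunDual stdComplexGaussian L =
      Complex.exp (-((L 1 ^ 2 + L Complex.I ^ 2) / 4 : ℝ)) := by
  have h : stdComplexGaussian = ((gaussianReal 0 (1 / 2 : ℝ≥0)).prod
      (gaussianReal 0 (1 / 2 : ℝ≥0))).map
        (Complex.equivRealProdCLM.symm.toContinuousLinearMap) := rfl
  rw [h, charFunDual_map, charFunDual_prod, charFunDual_gaussianReal, charFunDual_gaussianReal,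
    ← Complex.exp_add]
  have e1 : Complex.equivRealProdCLM.symm (1, 0) = 1 := by
    apply Complex.ext <;> simp
  have e2 : Complex.equivRealProdCLM.symm (0, 1) = Complex.I := by
    apply Complex.ext <;> simp
  simp only [ContinuousLinearMap.comp_apply, ContinuousLinearMap.inl_apply,
    ContinuousLinearMap.inr_apply, ContinuousLinearEquiv.coe_coe, e1, e2]
  congr 1
  push_cast
  ring

/-- Encoding a real functional by a complex vector `c` turns composition with `U` into `c ᵥ* U`. -/
theorem StrongDual.apply_eq_re_dotProduct {ι : Type*} [Fintype ι] [DecidableEq ι]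
    (L : StrongDual ℝ (ι → ℂ)) (x : ι → ℂ) :
    L x = ((fun i ↦ (⟨L (Pi.single i 1), -L (Pi.single i Complex.I)⟩ : ℂ)) ⬝ᵥ x).re := by
  have hx : x = ∑ i, ((x i).re • (Pi.single i 1 : ι → ℂ) +
      (x i).im • (Pi.single i Complex.I : ι → ℂ)) := by
    ext j
    simp only [Finset.sum_apply, Pi.add_apply, Pi.smul_apply, Finset.sum_add_distrib,
      Pi.single_apply, smul_ite, smul_zero, Finset.sum_ite_eq, Finset.mem_univ, if_true]
    apply Complex.ext <;> simp
  conv_lhs => rw [hx]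
  simp only [map_sum, map_add, map_smul, dotProduct, Complex.re_sum, Complex.mul_re, smul_eq_mul]
  exact Finset.sum_congr rfl fun i _ ↦ by ring

/-- The value depends on `c` only through its Hermitian norm, whence unitary invariance. -/
theorem charFunDual_pi_stdComplexGaussian {ι : Type*} [Fintype ι] [DecidableEq ι]
    {L : StrongDual ℝ (ι → ℂ)} {c : ι → ℂ} (h : ∀ x, L x = (c ⬝ᵥ x).re) :
    charFunDual (Measure.pi fun _ : ι ↦ stdComplexGaussian) L =
      Complex.exp (-(c ⬝ᵥ star c) / 4) := by
  rw [charFunDual_pi]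
  simp only [charFunDual_stdComplexGaussian, ← Complex.exp_sum, ContinuousLinearMap.comp_apply,
    ContinuousLinearMap.single_apply, h, dotProduct_single, mul_one]
  congr 1
  rw [neg_div, dotProduct, Finset.sum_div, ← Finset.sum_neg_distrib]
  refine Finset.sum_congr rfl fun i _ ↦ ?_
  rw [Pi.star_apply, Complex.star_def, Complex.mul_conj, Complex.normSq_apply]
  simp only [Complex.mul_re, Complex.I_re, Complex.I_im]
  push_cast
  ring

/-- A vector of independent standard complex Gaussians is invariant in law under unitary maps. -/
theorem measurePreserving_mulVec_pi_stdComplexGaussian {ι : Type*} [Fintype ι] [DecidableEq ι]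
    {U : Matrix ι ι ℂ} (hU : U ∈ Matrix.unitaryGroup ι ℂ) :
    MeasurePreserving (fun x : ι → ℂ ↦ U *ᵥ x) (Measure.pi fun _ : ι ↦ stdComplexGaussian)
      (Measure.pi fun _ : ι ↦ stdComplexGaussian) := by
  let T : (ι → ℂ) →L[ℝ] (ι → ℂ) := LinearMap.toContinuousLinearMap (U.mulVecLin.restrictScalars ℝ)
  have hT : ∀ x, T x = U *ᵥ x := fun _ ↦ rfl
  refine ⟨T.continuous.measurable, ?_⟩
  change Measure.map T _ = _
  have : IsProbabilityMeasure (Measure.map T (Measure.pi fun _ : ι ↦ stdComplexGaussian)) :=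
    Measure.isProbabilityMeasure_map T.continuous.aemeasurable
  refine Measure.ext_of_charFunDual (funext fun L ↦ ?_)
  obtain ⟨c, hc⟩ : ∃ c : ι → ℂ, ∀ x, L x = (c ⬝ᵥ x).re := ⟨_, L.apply_eq_re_dotProduct⟩
  have hc' : ∀ x, (L.comp T) x = ((c ᵥ* U) ⬝ᵥ x).re := fun x ↦ by
    rw [ContinuousLinearMap.comp_apply, hT, hc, Matrix.dotProduct_mulVec]
  rw [charFunDual_map, charFunDual_pi_stdComplexGaussian hc, charFunDual_pi_stdComplexGaussian hc',
    Matrix.star_vecMul, ← Matrix.dotProduct_mulVec, Matrix.mulVec_mulVec,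
    ← Matrix.star_eq_conjTranspose, Matrix.mem_unitaryGroup_iff.1 hU, Matrix.one_mulVec]

theorem measurePreserving_curry_pi {ι κ X : Type*} [Fintype ι] [Fintype κ] [MeasurableSpace X]
    (μ : Measure X) [IsProbabilityMeasure μ] :
    MeasurePreserving (MeasurableEquiv.curry ι κ X) (Measure.pi fun _ ↦ μ)
      (Measure.pi fun _ ↦ Measure.pi fun _ ↦ μ) := by
  refine ⟨MeasurableEquiv.measurable _, ?_⟩
  have := Measure.infinitePi_map_curry (ι := ι) (κ := κ) (fun _ _ ↦ μ)
  simpa only [Measure.infinitePi_eq_pi] using this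

open scoped Kronecker in
/-- A matrix of independent standard complex Gaussians is invariant in law under multiplication
by a unitary matrix from the left. -/
theorem measurePreserving_unitary_mul_pi_stdComplexGaussian {m n : Type*} [Fintype m]
    [DecidableEq m] [Fintype n] [DecidableEq n] {U : Matrix m m ℂ}
    (hU : U ∈ Matrix.unitaryGroup m ℂ) :
    MeasurePreserving (fun (A : m → n → ℂ) i j ↦ (U * Matrix.of A) i j)
      (Measure.pi fun _ ↦ Measure.pi fun _ ↦ stdComplexGaussian)
      (Measure.pi fun _ ↦ Measure.pi fun _ ↦ stdComplexGaussian) := by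
  have hc := measurePreserving_curry_pi (ι := m) (κ := n) stdComplexGaussian
  -- On the vector of all entries, left multiplication by `U` acts as the unitary `U ⊗ 1`.
  have hk := measurePreserving_mulVec_pi_stdComplexGaussian
    (Matrix.kronecker_mem_unitary hU (one_mem (Matrix.unitaryGroup n ℂ)))
  have := (hc.comp hk).comp (hc.symm _)
  convert this using 1
  ext A i j
  simp [Matrix.mul_apply, Matrix.mulVec, dotProduct, Fintype.sum_prod_type, Matrix.one_apply]

/-! ### The determinant as a function of one row -/

namespace Matrix

theorem PosSemidef.exists_unitary_dotProduct_mulVec_star {n : Type*} [Fintype n] [DecidableEq n]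
    {Q : Matrix n n ℂ} (hQ : Q.PosSemidef) :
    ∃ V ∈ unitaryGroup n ℂ, ∃ w : n → ℝ, (∀ i, 0 ≤ w i) ∧
      ∀ y, (y ⬝ᵥ (Q *ᵥ star y)).re = ∑ i, w i * Complex.normSq ((V *ᵥ y) i) := by
  set V := hQ.1.eigenvectorUnitary with hV
  have hsp : Q = (V : Matrix n n ℂ) * diagonal (fun i ↦ (hQ.1.eigenvalues i : ℂ)) *
      (V : Matrix n n ℂ)ᴴ := by
    have := hQ.1.spectral_theorem
    rw [Unitary.conjStarAlgAut_apply] at this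
    exact this
  -- The conjugate sits on the right-hand argument of the form, so the diagonalising unitary enters
  -- transposed.
  refine ⟨(V : Matrix n n ℂ)ᵀ, ?_, hQ.1.eigenvalues, hQ.eigenvalues_nonneg, fun y ↦ ?_⟩
  · rw [mem_unitaryGroup_iff]
    change (V : Matrix n n ℂ)ᵀ * ((V : Matrix n n ℂ)ᴴ)ᵀ = 1
    rw [← transpose_mul, ← star_eq_conjTranspose, mem_unitaryGroup_iff'.1 V.2, transpose_one]
  · generalize hQ.1.eigenvalues = w at hsp ⊢
    generalize (V : Matrix n n ℂ) = V at hsp ⊢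
    subst hsp
    conv_lhs => rw [← mulVec_mulVec, ← mulVec_mulVec, dotProduct_mulVec, ← star_vecMul,
      ← mulVec_transpose]
    rw [dotProduct, Complex.re_sum]
    refine Finset.sum_congr rfl fun i _ ↦ ?_
    rw [mulVec_diagonal, Pi.star_apply, Complex.star_def, mul_left_comm, Complex.mul_conj,
      ← Complex.ofReal_mul, Complex.ofReal_re]

/-- One row contributes a rank-one term to the Gram matrix, so the matrix determinant lemma applies.
-/
theorem conjTranspose_updateRow_mul_updateRow {m n : Type*} [Fintype m] [DecidableEq m]
    (A : Matrix m n ℂ) (i : m) (y : n → ℂ) :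
    (A.updateRow i y)ᴴ * A.updateRow i y = (A.updateRow i 0)ᴴ * A.updateRow i 0 +
      replicateCol Unit (star y) * replicateRow Unit y := by
  ext j k
  simp only [mul_apply, add_apply, conjTranspose_apply, Fintype.sum_eq_add_sum_compl i,
    updateRow_self, Pi.zero_apply, mul_zero, zero_add, Finset.univ_unique, Finset.sum_singleton,
    replicateCol_apply, replicateRow_apply, Pi.star_apply]
  rw [add_comm]
  congr 1
  refine Finset.sum_congr rfl fun l hl ↦ ?_
  have hl : l ≠ i := by simpa using hl
  simp [updateRow_ne hl]

theorem one_add_mul_mul_conjTranspose_posDef {m n : Type*} [Fintype m] [DecidableEq m] [Fintype n]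
    {K : Matrix n n ℂ} (hK : K.PosSemidef) (A : Matrix m n ℂ) : (1 + A * K * Aᴴ).PosDef :=
  PosDef.one.add_posSemidef (hK.mul_mul_conjTranspose_same A)

/-- As a function of a single row of `A`, `det (1 + A K Aᴴ)` is a positive multiple of one plus a
positive semidefinite quadratic form. -/
theorem exists_re_det_one_add_updateRow_eq {m n : Type*} [Fintype m] [DecidableEq m] [Fintype n]
    [DecidableEq n] {K : Matrix n n ℂ} (hK : K.PosSemidef) (A : Matrix m n ℂ) (i : m) :
    ∃ β : ℝ, 0 < β ∧ ∃ Q : Matrix n n ℂ, Q.PosSemidef ∧ ∀ y,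
      (1 + A.updateRow i y * K * (A.updateRow i y)ᴴ).det.re =
        β * (1 + (y ⬝ᵥ (Q *ᵥ star y)).re) := by
  open scoped MatrixOrder in
  obtain ⟨E, hE⟩ := CStarAlgebra.nonneg_iff_eq_star_mul_self.mp hK.nonneg
  rw [star_eq_conjTranspose] at hE
  set M : Matrix n n ℂ := 1 + E * ((A.updateRow i 0)ᴴ * A.updateRow i 0) * Eᴴ with hMdef
  have hM : M.PosDef := one_add_mul_mul_conjTranspose_posDef (posSemidef_conjTranspose_mul_self _) E
  have hdet := Complex.pos_iff.1 hM.det_pos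
  refine ⟨M.det.re, hdet.1, Eᴴ * M⁻¹ * E, hM.inv.posSemidef.conjTranspose_mul_mul_same E,
    fun y ↦ ?_⟩
  -- Writing `K = EᴴE`, the identity `det (1 + XY) = det (1 + YX)` passes to size `n`, where the
  -- Gram matrix of the rows appears.
  have h1 : (1 + A.updateRow i y * K * (A.updateRow i y)ᴴ).det =
      (M + (E * replicateCol Unit (star y)) * (replicateRow Unit y * Eᴴ)).det := by
    rw [hE, ← Matrix.mul_assoc, Matrix.mul_assoc, det_one_add_mul_comm, ← Matrix.mul_assoc,
      Matrix.mul_assoc E, conjTranspose_updateRow_mul_updateRow, hMdef]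
    simp only [Matrix.mul_add, Matrix.add_mul, Matrix.mul_assoc, add_assoc]
  rw [h1, det_add_mul _ _ (isUnit_iff_ne_zero.2 hM.det_pos.ne'), det_unique (n := Unit)]
  have h2 : (1 + replicateRow Unit y * Eᴴ * M⁻¹ * (E * replicateCol Unit (star y)) :
      Matrix Unit Unit ℂ) default default = 1 + y ⬝ᵥ ((Eᴴ * M⁻¹ * E) *ᵥ star y) := by
    have : replicateRow Unit y * Eᴴ * M⁻¹ * (E * replicateCol Unit (star y)) =
        replicateRow Unit y * ((Eᴴ * M⁻¹ * E) * replicateCol Unit (star y)) := by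
      simp only [Matrix.mul_assoc]
    rw [this, add_apply, one_apply_eq, ← replicateCol_mulVec, replicateRow_mul_replicateCol_apply]
  rw [h2, Complex.mul_re, ← hdet.2, zero_mul, sub_zero, Complex.add_re, Complex.one_re]

end Matrix

/-! ### Comparison of sublevel sets -/

/-- The mass of a centred ellipsoid does not decrease when the shift is scaled down. -/
theorem pi_stdComplexGaussian_setOf_quadratic_add_le {n : Type*} [Fintype n] [DecidableEq n]
    {Q : Matrix n n ℂ} (hQ : Q.PosSemidef) {s : ℝ} (hs0 : 0 ≤ s) (hs1 : s ≤ 1) (c : ℝ)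
    (d : n → ℂ) :
    Measure.pi (fun _ : n ↦ stdComplexGaussian)
        {y | ((y + d) ⬝ᵥ (Q *ᵥ star (y + d))).re ≤ c} ≤
      Measure.pi (fun _ : n ↦ stdComplexGaussian)
        {y | ((y + s • d) ⬝ᵥ (Q *ᵥ star (y + s • d))).re ≤ c} := by
  obtain ⟨V, hV, w, hw, hq⟩ := hQ.exists_unitary_dotProduct_mulVec_star
  have hm : ∀ d : n → ℂ, MeasurableSet {x : n → ℂ | ∑ i, w i * Complex.normSq (x i + d i) ≤ c} :=
    fun d ↦ (isClosed_le (continuous_finsetSum _ fun i _ ↦ continuous_const.mul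
      (Complex.continuous_normSq.comp (by fun_prop))) continuous_const).measurableSet
  have hset : ∀ d : n → ℂ, Measure.pi (fun _ : n ↦ stdComplexGaussian)
        {y | ((y + d) ⬝ᵥ (Q *ᵥ star (y + d))).re ≤ c} =
      Measure.pi (fun _ : n ↦ stdComplexGaussian)
        {x | ∑ i, w i * Complex.normSq (x i + (V *ᵥ d) i) ≤ c} := fun d ↦ by
    rw [← (measurePreserving_mulVec_pi_stdComplexGaussian hV).measure_preimage
      (hm _).nullMeasurableSet]
    congr 1
    ext y
    simp only [Set.mem_ofPred_eq, Set.mem_preimage, hq, Matrix.mulVec_add, Pi.add_apply]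
  rw [hset, hset, Matrix.mulVec_smul]
  exact pi_stdComplexGaussian_setOf_sum_normSq_add_le hw hs0 hs1 c _

section SublevelSets

variable {m n : Type*} [Fintype m] [DecidableEq m] [Fintype n]

theorem measurableSet_setOf_re_det_le (K : Matrix n n ℂ) (D : Matrix m n ℂ) (c : ℝ) :
    MeasurableSet {A : m → n → ℂ |
      (1 + (Matrix.of A + D) * K * (Matrix.of A + D)ᴴ).det.re ≤ c} := by
  have h : Continuous fun A : m → n → ℂ ↦ Matrix.of A + D := by
    exact (continuous_id (X := m → n → ℂ)).add continuous_const
  exact (isClosed_le (Complex.continuous_re.comp (continuous_const.add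
    ((h.matrix_mul continuous_const).matrix_mul h.matrix_conjTranspose)).matrix_det)
    continuous_const).measurableSet

variable [DecidableEq n]

theorem pi_pi_stdComplexGaussian_setOf_re_det_le_unitary_mul (K : Matrix n n ℂ)
    {U : Matrix m m ℂ} (hU : U ∈ Matrix.unitaryGroup m ℂ) (D : Matrix m n ℂ) (c : ℝ) :
    Measure.pi (fun _ : m ↦ Measure.pi fun _ : n ↦ stdComplexGaussian)
        {A | (1 + (Matrix.of A + U * D) * K * (Matrix.of A + U * D)ᴴ).det.re ≤ c} =
      Measure.pi (fun _ : m ↦ Measure.pi fun _ : n ↦ stdComplexGaussian)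
        {A | (1 + (Matrix.of A + D) * K * (Matrix.of A + D)ᴴ).det.re ≤ c} := by
  rw [← (measurePreserving_unitary_mul_pi_stdComplexGaussian hU).measure_preimage
    (measurableSet_setOf_re_det_le K _ c).nullMeasurableSet]
  congr 1
  ext A
  simp only [Set.mem_ofPred_eq, Set.mem_preimage]
  have h : Matrix.of (fun i j ↦ (U * Matrix.of A) i j) + U * D = U * (Matrix.of A + D) := (Matrix.mul_add _ _ _).symm
  rw [h]
  set B := Matrix.of A + D
  have : U * B * K * (U * B)ᴴ = U * (B * K * Bᴴ * Uᴴ) := by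
    simp only [Matrix.conjTranspose_mul, Matrix.mul_assoc]
  rw [this, Matrix.det_one_add_mul_comm, Matrix.mul_assoc _ Uᴴ, ← Matrix.star_eq_conjTranspose U,
    Matrix.mem_unitaryGroup_iff'.1 hU, Matrix.mul_one]

/-- Once the other rows are frozen, a sublevel set becomes a shifted ellipsoid in row `i`, and
scaling row `i` of the mean shrinks its shift. -/
theorem pi_pi_stdComplexGaussian_setOf_re_det_le_diagonal_mul {K : Matrix n n ℂ}
    (hK : K.PosSemidef) {s : m → ℝ} (hs : ∀ i, 0 ≤ s i ∧ s i ≤ 1) (D : Matrix m n ℂ) (c : ℝ) :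
    Measure.pi (fun _ : m ↦ Measure.pi fun _ : n ↦ stdComplexGaussian)
        {A | (1 + (Matrix.of A + D) * K * (Matrix.of A + D)ᴴ).det.re ≤ c} ≤
      Measure.pi (fun _ : m ↦ Measure.pi fun _ : n ↦ stdComplexGaussian)
        {A | (1 + (Matrix.of A + Matrix.diagonal (fun i ↦ (s i : ℂ)) * D) * K *
          (Matrix.of A + Matrix.diagonal (fun i ↦ (s i : ℂ)) * D)ᴴ).det.re ≤ c} := by
  have hdiag : Matrix.diagonal (fun i ↦ (s i : ℂ)) * D = Matrix.of (fun i ↦ s i • D i) := by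
    ext i j
    simp
  rw [hdiag]
  refine le_apply_smul_of_le_apply_update_smul (fun d : m → n → ℂ ↦
    Measure.pi (fun _ : m ↦ Measure.pi fun _ : n ↦ stdComplexGaussian)
      {A | (1 + (Matrix.of A + Matrix.of d) * K * (Matrix.of A + Matrix.of d)ᴴ).det.re ≤ c}) s
    (fun d i ↦ ?_) D
  refine Measure.pi_le_pi_of_update _ i (measurableSet_setOf_re_det_le K _ c)
    (measurableSet_setOf_re_det_le K _ c) fun x ↦ ?_
  obtain ⟨β, hβ, Q, hQ, hdet⟩ :=
    Matrix.exists_re_det_one_add_updateRow_eq hK (Matrix.of x + Matrix.of d) i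
  have h1 : ∀ y, Matrix.of (Function.update x i y) + Matrix.of d =
      (Matrix.of x + Matrix.of d).updateRow i (y + d i) := fun y ↦ by
    ext k l
    by_cases hk : k = i
    · subst hk; simp
    · simp [hk, Matrix.updateRow_ne]
  have h2 : ∀ y, Matrix.of (Function.update x i y) +
        Matrix.of (Function.update d i (s i • d i)) =
      (Matrix.of x + Matrix.of d).updateRow i (y + s i • d i) := fun y ↦ by
    ext k l
    by_cases hk : k = i
    · subst hk; simp
    · simp [hk, Matrix.updateRow_ne]
  simp only [Set.mem_ofPred_eq, h1, h2, hdet, ← le_div_iff₀' hβ, ← le_sub_iff_add_le']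
  exact pi_stdComplexGaussian_setOf_quadratic_add_le hQ (hs i).1 (hs i).2 _ _

theorem pi_pi_stdComplexGaussian_setOf_re_det_le_mono {K : Matrix n n ℂ} (hK : K.PosSemidef)
    {D D' : Matrix m n ℂ} (hD : (Dᴴ * D - D'ᴴ * D').PosSemidef) (c : ℝ) :
    Measure.pi (fun _ : m ↦ Measure.pi fun _ : n ↦ stdComplexGaussian)
        {A | (1 + (Matrix.of A + D) * K * (Matrix.of A + D)ᴴ).det.re ≤ c} ≤
      Measure.pi (fun _ : m ↦ Measure.pi fun _ : n ↦ stdComplexGaussian)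
        {A | (1 + (Matrix.of A + D') * K * (Matrix.of A + D')ᴴ).det.re ≤ c} := by
  obtain ⟨C, hC, rfl⟩ := Matrix.exists_contraction_mul_eq hD
  obtain ⟨U, hU, W, hW, s, hs, rfl⟩ := Matrix.exists_unitary_diagonal_unitary hC
  -- `U` is dropped from the smaller mean, and `D` is replaced by `W D` so that only the diagonal
  -- factor separates the two sides.
  rw [Matrix.mul_assoc, Matrix.mul_assoc,
    pi_pi_stdComplexGaussian_setOf_re_det_le_unitary_mul K hU,
    ← pi_pi_stdComplexGaussian_setOf_re_det_le_unitary_mul K hW D]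
  exact pi_pi_stdComplexGaussian_setOf_re_det_le_diagonal_mul hK hs _ c

end SublevelSets

/-! ### Transfer to the random matrix -/

theorem logDetValue_le_iff {m n : ℕ} {K : Matrix (Fin n) (Fin n) ℂ} (hK : K.PosSemidef)
    (A : Matrix (Fin m) (Fin n) ℂ) (t : ℝ) :
    logDetValue K A ≤ t ↔ (1 + A * K * Aᴴ).det.re ≤ Real.exp t :=
  Real.log_le_iff_le_exp
    (Complex.pos_iff.1 (Matrix.one_add_mul_mul_conjTranspose_posDef hK A).det_pos).1

theorem IsIIDStdComplexGaussian.hasLaw_pi_pi {Ω : Type*} [MeasurableSpace Ω] {P : Measure Ω}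
    [IsProbabilityMeasure P] {m n : ℕ} {H : Ω → Matrix (Fin m) (Fin n) ℂ}
    (hH : IsIIDStdComplexGaussian P H) :
    HasLaw (fun ω i j ↦ H ω i j)
      (Measure.pi fun _ : Fin m ↦ Measure.pi fun _ : Fin n ↦ stdComplexGaussian) P := by
  have hc := measurePreserving_curry_pi (ι := Fin m) (κ := Fin n) stdComplexGaussian
  have haem : ∀ p : Fin m × Fin n, AEMeasurable (fun ω ↦ H ω p.1 p.2) P :=
    fun p ↦ (hH.hasLaw p.1 p.2).aemeasurable
  have hlaw : HasLaw (fun ω (p : Fin m × Fin n) ↦ H ω p.1 p.2)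
      (Measure.pi fun _ ↦ stdComplexGaussian) P := by
    refine ⟨aemeasurable_pi_lambda _ haem, ?_⟩
    rw [(iIndepFun_iff_map_fun_eq_pi_map haem).1 hH.indep]
    congr 1
    ext1 p
    exact (hH.hasLaw p.1 p.2).map_eq
  have hcl : HasLaw (MeasurableEquiv.curry (Fin m) (Fin n) ℂ) _ (Measure.pi _) :=
    ⟨hc.measurable.aemeasurable, hc.map_eq⟩
  exact hcl.comp hlaw

theorem theorem1 {Ω : Type*} [MeasurableSpace Ω] (P : Measure Ω) [IsProbabilityMeasure P]
    (m n : ℕ) (H : Ω → Matrix (Fin m) (Fin n) ℂ) (hH : IsIIDStdComplexGaussian P H)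
    (D D' : Matrix (Fin m) (Fin n) ℂ) (hD : (Dᴴ * D - D'ᴴ * D').PosSemidef)
    (t : ℝ) (ht : 0 ≤ t) (K : Matrix (Fin n) (Fin n) ℂ) (hK : K.PosSemidef) :
    P {ω | logDetValue K (H ω + D) ≤ t} ≤ P {ω | logDetValue K (H ω + D') ≤ t} := by
  simp only [logDetValue_le_iff hK]
  have h := fun D ↦ hH.hasLaw_pi_pi.measure_eq (measurableSet_setOf_re_det_le K D (Real.exp t))
  exact (h D).trans_le ((pi_pi_stdComplexGaussian_setOf_re_det_le_mono hK hD _).trans_eq (h D').symm)
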